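/- Let $0<\varepsilon<1/6$ and consider the symmetric $7\times 7$ game with payoff matrix $$\mathbf U=\begin{pmatrix} 0&-1&\varepsilon&-10&-\frac13+\varepsilon&-\frac13+\varepsilon&-\frac13+\varepsilon\\ \varepsilon&0&-1&-10&-\frac13+\varepsilon&-\frac13+\varepsilon&-\frac13+\varepsilon\\ -1&\varepsilon&0&-10&-\frac13+\varepsilon&-\frac13+\varepsilon&-\frac13+\varepsilon\\ -2&-2&2&0&-\frac13&-\frac13&-\frac13\\ -\frac13&-\frac13&-\frac13&10&0&-1&\varepsilon\\ -\frac13&-\frac13&-\frac13&10&\varepsilon&0&-1\\ -\frac13&-\frac13&-\frac13&10&-1&\varepsilon&0 \end{pmatrix}.$$ Let $S_7=\{\mathbf x\in\mathbb R^7: x_i\ge 0,\ \sum_i x_i=1\}$ with vertices $\mathbf e_1,\dots,\mathbf e_7$, and consider on $S_7$ the replicator dynamics $\dot x_i=x_i\left[(\mathbf U\mathbf x)_i-\mathbf x\cdot\mathbf U\mathbf x\right]$, $1\le i\le 7$. Let $$\Gamma_{567}=\{\mathbf x\in S_7: x_5+x_6+x_7=1\text{ and }x_5x_6x_7=0\},\qquad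 \mathbf n_{567}=\left(0,0,0,0,\tfrac13,\tfrac13,\tfrac13\right).$$ The set $\Gamma_{567}$ is a heteroclinic cycle $\mathbf e_5\to\mathbf e_6\to\mathbf e_7\to\mathbf e_5$: it consists of the three rest points $\mathbf e_5,\mathbf e_6,\mathbf e_7$, which are saddles (hyperbolic in $S_7$, with both stable and unstable directions), and of complete orbits connecting each of them to the next. Although $(\mathbf n_{567},\mathbf n_{567})$ is not a Nash equilibrium of the game, $\Gamma_{567}$ is asymptotically stable under the replicator dynamics on $S_7$: for every neighbourhood $W$ of $\Gamma_{567}$ there is a neighbourhood $V$ of $\Gamma_{567}$ such that every solution with $\mathbf x(0)\in V\cap S_7$ satisfies $\mathbf x(t)\in W$ for all $t\ge 0$; and there is a neighbourhood $V_0$ of $\Gamma_{567}$ such that every solution with $\mathbf x(0)\in V_0\cap S_7$ satisfies $\operatorname{dist}(\mathbf x(t),\Gamma_{567})\to 0$ as $t\to+\infty$. -/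

import Mathlib

open Filter Topology Matrix

noncomputable section

namespace SymmetricGame

variable {ι : Type*} [Fintype ι]

/-- `(x, y)` is a Nash equilibrium (in mixed strategies) of the symmetric bimatrix game whose row
player has payoff matrix `U`: each strategy is a best reply to the other one. -/
def IsNashEquilibrium (U : Matrix ι ι ℝ) (x y : ι → ℝ) : Prop :=
  x ∈ stdSimplex ℝ ι ∧ y ∈ stdSimplex ℝ ι ∧
    (∀ z ∈ stdSimplex ℝ ι, z ⬝ᵥ (U *ᵥ y) ≤ x ⬝ᵥ (U *ᵥ y)) ∧
    (∀ z ∈ stdSimplex ℝ ι, z ⬝ᵥ (U *ᵥ x) ≤ y ⬝ᵥ (U *ᵥ x))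

/-- The replicator vector field `x ↦ (xᵢ [(U x)ᵢ - x · U x])ᵢ`. -/
def replicatorField (U : Matrix ι ι ℝ) (x : ι → ℝ) : ι → ℝ :=
  fun i => x i * ((U *ᵥ x) i - x ⬝ᵥ (U *ᵥ x))

/-- `x` is, on the time set `s`, a solution of the replicator dynamics in the simplex.
It is used with `s = ℝ` (complete orbits) and with `s = [0, ∞)` (forward orbits). -/
structure IsReplicatorSolutionOn (U : Matrix ι ι ℝ) (x : ℝ → ι → ℝ) (s : Set ℝ) : Prop where
  mem_simplex : ∀ t ∈ s, x t ∈ stdSimplex ℝ ι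
  ode : IsIntegralCurveOn x (fun _ => replicatorField U) s

/-- `Γ` is Lyapunov stable for the replicator dynamics on the simplex: forward solutions that
start close enough to `Γ` stay close to `Γ`. -/
def IsLyapunovStable (U : Matrix ι ι ℝ) (Γ : Set (ι → ℝ)) : Prop :=
  ∀ W ∈ 𝓝ˢ Γ, ∃ V ∈ 𝓝ˢ Γ, ∀ x : ℝ → ι → ℝ,
    IsReplicatorSolutionOn U x (Set.Ici 0) → x 0 ∈ V → ∀ t, 0 ≤ t → x t ∈ W

/-- `Γ` is attracting for the replicator dynamics on the simplex: all forward solutions that start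
in some neighbourhood of `Γ` converge to `Γ`. For compact `Γ`, `Tendsto x atTop (𝓝ˢ Γ)` says that
the distance from `x t` to `Γ` tends to `0`. -/
def IsAttracting (U : Matrix ι ι ℝ) (Γ : Set (ι → ℝ)) : Prop :=
  ∃ V ∈ 𝓝ˢ Γ, ∀ x : ℝ → ι → ℝ,
    IsReplicatorSolutionOn U x (Set.Ici 0) → x 0 ∈ V → Tendsto x atTop (𝓝ˢ Γ)

/-- Asymptotic stability of a (compact) set: Lyapunov stable and attracting. -/
def IsAsymptoticallyStable (U : Matrix ι ι ℝ) (Γ : Set (ι → ℝ)) : Prop :=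
  IsLyapunovStable U Γ ∧ IsAttracting U Γ

variable [DecidableEq ι]

/-- The complex number `c` is an eigenvalue of the linearization of the replicator vector field
at `p`, restricted to the (complexified) tangent space `{v | ∑ vᵢ = 0}` of the simplex. -/
def IsTangentEigenvalue (U : Matrix ι ι ℝ) (p : ι → ℝ) (c : ℂ) : Prop :=
  ∃ v : ι → ℂ, v ≠ 0 ∧ ∑ i, v i = 0 ∧
    ((LinearMap.toMatrix' (fderiv ℝ (replicatorField U) p : (ι → ℝ) →ₗ[ℝ] (ι → ℝ))).map
      Complex.ofReal) *ᵥ v = c • v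

/-- `p` is a saddle rest point of the replicator dynamics on the simplex: a hyperbolic rest point
with both unstable and stable directions. -/
structure IsSaddle (U : Matrix ι ι ℝ) (p : ι → ℝ) : Prop where
  mem_simplex : p ∈ stdSimplex ℝ ι
  rest : replicatorField U p = 0
  hyperbolic : ∀ c, IsTangentEigenvalue U p c → c.re ≠ 0
  unstable : ∃ c, IsTangentEigenvalue U p c ∧ 0 < c.re
  stable : ∃ c, IsTangentEigenvalue U p c ∧ c.re < 0

/-- `x` lies on a complete orbit of the replicator dynamics that stays in `Γ`, comes from the
point `p` and goes to the point `q`. -/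
def OnConnectingOrbit (U : Matrix ι ι ℝ) (Γ : Set (ι → ℝ)) (p q x : ι → ℝ) : Prop :=
  ∃ y : ℝ → ι → ℝ, IsReplicatorSolutionOn U y Set.univ ∧ y 0 = x ∧ (∀ t, y t ∈ Γ) ∧
    Tendsto y atBot (𝓝 p) ∧ Tendsto y atTop (𝓝 q)

/-- `Γ` is a heteroclinic cycle `p 0 → p 1 → ⋯ → p (m - 1) → p 0` (addition in `Fin m` is cyclic):
it consists of the distinct saddle rest points `p k` and of orbits that connect `p k` to
`p (k + 1)`, and for each `k` there is such an orbit. In particular `Γ` is invariant. -/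
structure IsHeteroclinicCycle (U : Matrix ι ι ℝ) (Γ : Set (ι → ℝ)) {m : ℕ} [NeZero m]
    (p : Fin m → ι → ℝ) : Prop where
  two_le : 2 ≤ m
  injective : Function.Injective p
  mem : ∀ k, p k ∈ Γ
  saddle : ∀ k, IsSaddle U (p k)
  consists : ∀ x ∈ Γ, x ∉ Set.range p → ∃ k, OnConnectingOrbit U Γ (p k) (p (k + 1)) x
  connects : ∀ k, ∃ x ∈ Γ, x ∉ Set.range p ∧ OnConnectingOrbit U Γ (p k) (p (k + 1)) x

end SymmetricGame

/-- The payoff matrix of the `7 × 7` game. Strategies `1, …, 7` are the indices `0, …, 6`. -/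
def game77 (ε : ℝ) : Matrix (Fin 7) (Fin 7) ℝ :=
  !![    0,     -1,      ε, -10, -1/3 + ε, -1/3 + ε, -1/3 + ε;
         ε,      0,     -1, -10, -1/3 + ε, -1/3 + ε, -1/3 + ε;
        -1,      ε,      0, -10, -1/3 + ε, -1/3 + ε, -1/3 + ε;
        -2,     -2,      2,   0,     -1/3,     -1/3,     -1/3;
      -1/3,   -1/3,   -1/3,  10,        0,       -1,        ε;
      -1/3,   -1/3,   -1/3,  10,        ε,        0,       -1;
      -1/3,   -1/3,   -1/3,  10,       -1,        ε,        0]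

/-- The mixed strategy `n₅₆₇ = (0, 0, 0, 0, 1/3, 1/3, 1/3)`. -/
def n567 : Fin 7 → ℝ := ![0, 0, 0, 0, 1/3, 1/3, 1/3]

/-- `Γ₅₆₇`: the points of the simplex with `x₅ + x₆ + x₇ = 1` and `x₅ x₆ x₇ = 0`. -/
def Gamma567 : Set (Fin 7 → ℝ) :=
  {x | x ∈ stdSimplex ℝ (Fin 7) ∧ x 4 + x 5 + x 6 = 1 ∧ x 4 * x 5 * x 6 = 0}

/-- The vertices `e₅, e₆, e₇` of the simplex. -/
def vertices567 : Fin 3 → Fin 7 → ℝ :=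
  ![Pi.single 4 1, Pi.single 5 1, Pi.single 6 1]

end

/-! On each edge of the cycle the dynamics reduces to a scalar equation of logistic type, solved
explicitly by `exists_logistic_solution`; this gives the connections. At a vertex `k` with `U k k =
0` the tangent eigenvalues are the payoffs `U j k`, `j ≠ k`, so the saddle property is read off a
column of the matrix. Asymptotic stability comes from a strict Lyapunov function that vanishes
exactly on the cycle. On the cycle, `x 4 * x 5 * x 6` and `x 3` have negative logarithmic growth
rates. The first three strategies grow at rate `-1/3 + ε + (1 - ε) p q` at edge weights `p`, `q`:
negative near vertices, but positive at the midpoint once `ε > 1/9`. The factor `exp (vandermonde567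
x)` repairs this. It adds the derivative of `vandermonde567` along the flow, which on an edge is `p
q (1 - 6 p q) (ε p + q)`: zero at the vertices and negative where `p q > 1/6`. By `edge_rate_lt` the
corrected rate is uniformly negative; continuity extends this to a neighbourhood, and
`isAsymptoticallyStable_of_lyapunov` concludes. -/

namespace SymmetricGame

/-! ### Scalar dynamics on an edge -/

/-- Global solutions of `y' = y (1 - y) (α (1 - y) + β y)` through every point of `(0, 1)`. -/
theorem exists_logistic_solution {α β : ℝ} (hα : 0 < α) (hβ : 0 < β) {s : ℝ} (hs0 : 0 < s)
    (hs1 : s < 1) :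
    ∃ y : ℝ → ℝ, y 0 = s ∧ (∀ t, 0 < y t ∧ y t < 1) ∧
      (∀ t, HasDerivAt y (y t * (1 - y t) * (α * (1 - y t) + β * y t)) t) ∧
      Tendsto y atBot (𝓝 0) ∧ Tendsto y atTop (𝓝 1) := by
  -- With `y = sigmoid r` the equation becomes `r' = (α + β exp r) / (1 + exp r)`. `T` is an
  -- antiderivative of the reciprocal, i.e. time as a function of `r`, and its inverse gives the
  -- solution.
  set T : ℝ → ℝ := fun r => r / α + (1 / β - 1 / α) * Real.log (α + β * Real.exp r) with hT
  have hden : ∀ r, 0 < α + β * Real.exp r := fun r => by positivity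
  have hTd : ∀ r, HasDerivAt T ((1 + Real.exp r) / (α + β * Real.exp r)) r := by
    intro r
    have h1 := (((Real.hasDerivAt_exp r).const_mul β).const_add α).log (hden r).ne'
    have h2 := ((hasDerivAt_id r).div_const α).add (h1.const_mul (1 / β - 1 / α))
    refine h2.congr_deriv ?_
    have := (hden r).ne'
    field_simp
    ring
  -- A uniform lower bound on the slope of `T` makes `T` onto, so solutions are global.
  set m : ℝ := 1 / (α + β) with hm
  have hmpos : 0 < m := by positivity
  have hmle : ∀ r, m ≤ (1 + Real.exp r) / (α + β * Real.exp r) := by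
    intro r
    rw [hm, div_le_div_iff₀ (by positivity) (hden r)]
    have := Real.exp_pos r
    nlinarith [mul_pos hα this]
  have hTpos : ∀ r, 0 < (1 + Real.exp r) / (α + β * Real.exp r) := fun r =>
    hmpos.trans_le (hmle r)
  have hTcont : Continuous T := continuous_iff_continuousAt.2 fun r => (hTd r).continuousAt
  have hTmono : StrictMono T := strictMono_of_hasDerivAt_pos hTd hTpos
  have hmono : Monotone fun r => T r - m * r := by
    have hd : ∀ r, HasDerivAt (fun r => T r - m * r)
        ((1 + Real.exp r) / (α + β * Real.exp r) - m) r := fun r => by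
      exact ((hTd r).sub ((hasDerivAt_id r).const_mul m)).congr_deriv (by simp)
    refine monotone_of_deriv_nonneg (fun r => (hd r).differentiableAt) fun r => ?_
    rw [(hd r).deriv]
    exact sub_nonneg.2 (hmle r)
  have hTtop : Tendsto T atTop atTop := by
    refine tendsto_atTop_mono' atTop (f₁ := fun r => T 0 + m * r) ?_
      (tendsto_atTop_add_const_left _ _ (tendsto_id.const_mul_atTop hmpos))
    filter_upwards [eventually_ge_atTop 0] with r hr
    have := hmono hr
    simp only at this
    linarith
  have hTbot : Tendsto T atBot atBot := by
    refine tendsto_atBot_mono' atBot (f₁ := fun r => T 0 + m * r) ?_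
      (tendsto_atBot_add_const_left _ _ (tendsto_id.const_mul_atBot hmpos))
    filter_upwards [eventually_le_atBot 0] with r hr
    have := hmono hr
    simp only at this
    linarith
  let Φ : ℝ ≃o ℝ := hTmono.orderIsoOfSurjective T (hTcont.surjective hTtop hTbot)
  have hΦ : ∀ t, T (Φ.symm t) = t := fun t => Φ.apply_symm_apply t
  have hΦd : ∀ t, HasDerivAt Φ.symm
      ((1 + Real.exp (Φ.symm t)) / (α + β * Real.exp (Φ.symm t)))⁻¹ t := fun t =>
    HasDerivAt.of_local_left_inverse Φ.symm.continuous.continuousAt (hTd _) (hTpos _).ne'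
      (Eventually.of_forall hΦ)
  obtain ⟨r, hr⟩ : s ∈ Set.range Real.sigmoid := by
    rw [Real.range_sigmoid]; exact ⟨hs0, hs1⟩
  refine ⟨fun t => Real.sigmoid (Φ.symm (t + T r)), ?_,
    fun t => ⟨Real.sigmoid_pos _, Real.sigmoid_lt_one _⟩, fun t => ?_, ?_, ?_⟩
  · have : Φ.symm (T r) = r := Φ.symm_apply_apply r
    simp [this, hr]
  · have h := ((Real.hasDerivAt_sigmoid (Φ.symm (t + T r))).comp _ (hΦd (t + T r))).comp_add_const
      t (T r)
    refine h.congr_deriv ?_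
    congr 1
    have hp := hden (Φ.symm (t + T r))
    have he := Real.exp_pos (Φ.symm (t + T r))
    simp only [Real.sigmoid_def, Real.exp_neg]
    field_simp
    ring
  · exact Real.tendsto_sigmoid_atBot.comp
      (Φ.symm.tendsto_atBot.comp (tendsto_atBot_add_const_right _ _ tendsto_id))
  · exact Real.tendsto_sigmoid_atTop.comp
      (Φ.symm.tendsto_atTop.comp (tendsto_atTop_add_const_right _ _ tendsto_id))

/-! ### Linearization of the replicator field -/

section Fintype

variable {ι : Type*} [Fintype ι]

/-- Along the line `p + t • w` each component is a polynomial in `t`; its linear coefficient is the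
directional derivative. -/
theorem fderiv_replicatorField_apply (U : Matrix ι ι ℝ) (p w : ι → ℝ) (i : ι) :
    fderiv ℝ (replicatorField U) p w i =
      w i * ((U *ᵥ p) i - p ⬝ᵥ (U *ᵥ p)) +
        p i * ((U *ᵥ w) i - w ⬝ᵥ (U *ᵥ p) - p ⬝ᵥ (U *ᵥ w)) := by
  have hdiff : DifferentiableAt ℝ (replicatorField U) p := by
    unfold replicatorField mulVec dotProduct
    fun_prop
  have hline : HasDerivAt (fun t : ℝ => p + t • w) w 0 := by
    simpa using ((hasDerivAt_id (0 : ℝ)).smul_const w).const_add p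
  have h1 : HasDerivAt (fun t : ℝ => replicatorField U (p + t • w))
      (fderiv ℝ (replicatorField U) p w) 0 :=
    HasFDerivAt.comp_hasDerivAt_of_eq (0 : ℝ) hdiff.hasFDerivAt hline (by simp)
  have h2 := hasDerivAt_pi.1 h1 i
  refine h2.unique ?_
  have h3 : HasDerivAt (fun t : ℝ => (p i + t * w i) *
      ((U *ᵥ p) i + t * (U *ᵥ w) i - (p ⬝ᵥ (U *ᵥ p) +
        (t * (w ⬝ᵥ (U *ᵥ p) + p ⬝ᵥ (U *ᵥ w)) + t * t * (w ⬝ᵥ (U *ᵥ w)))))) _ 0 :=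
    (((hasDerivAt_id (0 : ℝ)).mul_const (w i)).const_add (p i)).mul
      ((((hasDerivAt_id (0 : ℝ)).mul_const ((U *ᵥ w) i)).const_add ((U *ᵥ p) i)).sub
        ((((hasDerivAt_id (0 : ℝ)).mul_const (w ⬝ᵥ (U *ᵥ p) + p ⬝ᵥ (U *ᵥ w))).add
          (((hasDerivAt_id (0 : ℝ)).mul (hasDerivAt_id (0 : ℝ))).mul_const
            (w ⬝ᵥ (U *ᵥ w)))).const_add (p ⬝ᵥ (U *ᵥ p))))
  have hfun : (fun t : ℝ => replicatorField U (p + t • w) i) = fun t : ℝ => (p i + t * w i) *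
      ((U *ᵥ p) i + t * (U *ᵥ w) i - (p ⬝ᵥ (U *ᵥ p) +
        (t * (w ⬝ᵥ (U *ᵥ p) + p ⬝ᵥ (U *ᵥ w)) + t * t * (w ⬝ᵥ (U *ᵥ w))))) := by
    funext t
    simp only [replicatorField, mulVec_add, mulVec_smul, Pi.add_apply, Pi.smul_apply, smul_eq_mul,
      add_dotProduct, dotProduct_add, smul_dotProduct, dotProduct_smul]
    ring
  rw [hfun]
  refine h3.congr_deriv ?_
  simp only [id]
  ring

end Fintype

/-! ### Edges, connecting orbits and saddles at vertices -/

variable {ι : Type*} [DecidableEq ι]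

/-- The point of the edge from the vertex `i` to the vertex `j` with weight `s` on `j`. -/
def edgePoint (i j : ι) (s : ℝ) : ι → ℝ := Pi.single i (1 - s) + Pi.single j s

theorem continuous_edgePoint (i j : ι) : Continuous (edgePoint i j) := by
  refine continuous_pi fun k => ?_
  simp only [edgePoint, Pi.add_apply, Pi.single_apply]
  split_ifs <;> fun_prop

variable [Fintype ι]

theorem edgePoint_mem_stdSimplex (i j : ι) {s : ℝ} (h0 : 0 ≤ s) (h1 : s ≤ 1) :
    edgePoint i j s ∈ stdSimplex ℝ ι := by
  refine ⟨fun k => ?_, ?_⟩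
  · have h2 : (0 : ι → ℝ) ≤ Pi.single i (1 - s) := Pi.single_nonneg.2 (sub_nonneg.2 h1)
    have h3 : (0 : ι → ℝ) ≤ Pi.single j s := Pi.single_nonneg.2 h0
    exact add_nonneg (h2 k) (h3 k)
  · simp [edgePoint, Finset.sum_add_distrib]

theorem replicatorField_edgePoint {U : Matrix ι ι ℝ} {i j : ι} (hij : i ≠ j) (hi : U i i = 0)
    (hj : U j j = 0) (s : ℝ) :
    replicatorField U (edgePoint i j s) =
      (s * (1 - s) * (U j i * (1 - s) - U i j * s)) • (Pi.single j 1 - Pi.single i 1) := by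
  have hU : U *ᵥ edgePoint i j s = fun k => U k i * (1 - s) + U k j * s := by
    ext k
    simp [edgePoint, mulVec_add]
    ring
  have havg : edgePoint i j s ⬝ᵥ (U *ᵥ edgePoint i j s) = (U i j + U j i) * (s * (1 - s)) := by
    rw [hU]
    simp [edgePoint, hi, hj]
    ring
  ext k
  simp only [replicatorField]
  rw [havg, hU]
  by_cases hki : k = i
  · subst hki
    simp [edgePoint, hij, hi]
    ring
  · by_cases hkj : k = j
    · subst hkj
      simp [edgePoint, hki, hj]
      ring
    · simp [edgePoint, hki, hkj]

/-- Every interior point of an edge along which the payoffs favour `j` lies on an orbit that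
connects the vertex `i` to the vertex `j`. -/
theorem onConnectingOrbit_edgePoint {U : Matrix ι ι ℝ} {Γ : Set (ι → ℝ)} {i j : ι} (hij : i ≠ j)
    (hi : U i i = 0) (hj : U j j = 0) (hji : 0 < U j i) (hij' : U i j < 0)
    (hΓ : ∀ s, 0 ≤ s → s ≤ 1 → edgePoint i j s ∈ Γ) {s : ℝ} (hs0 : 0 < s) (hs1 : s < 1) :
    OnConnectingOrbit U Γ (Pi.single i 1) (Pi.single j 1) (edgePoint i j s) := by
  obtain ⟨y, hy0, hy, hyd, hbot, htop⟩ :=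
    exists_logistic_solution hji (neg_pos.2 hij') hs0 hs1
  have e0 : (Pi.single i 1 : ι → ℝ) = edgePoint i j 0 := by simp [edgePoint]
  have e1 : (Pi.single j 1 : ι → ℝ) = edgePoint i j 1 := by simp [edgePoint]
  refine ⟨fun t => edgePoint i j (y t),
    ⟨fun t _ => edgePoint_mem_stdSimplex i j (hy t).1.le (hy t).2.le, fun t _ => ?_⟩,
    by simp [hy0], fun t => hΓ _ (hy t).1.le (hy t).2.le, ?_, ?_⟩
  · refine HasDerivAt.hasDerivWithinAt ?_
    change HasDerivAt _ (replicatorField U (edgePoint i j (y t))) t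
    rw [replicatorField_edgePoint hij hi hj, hasDerivAt_pi]
    intro k
    have h : HasDerivAt (fun t => (1 - y t) * (Pi.single i 1 : ι → ℝ) k
        + y t * (Pi.single j 1 : ι → ℝ) k) _ t :=
      (((hyd t).const_sub 1).mul_const _).add ((hyd t).mul_const _)
    have hfun : (fun t => edgePoint i j (y t) k) = fun t =>
        (1 - y t) * (Pi.single i 1 : ι → ℝ) k + y t * (Pi.single j 1 : ι → ℝ) k := by
      funext t
      simp [edgePoint, Pi.single_apply]
    rw [hfun]
    refine h.congr_deriv ?_
    simp only [Pi.smul_apply, Pi.sub_apply, smul_eq_mul]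
    ring
  · rw [e0]
    exact ((continuous_edgePoint i j).tendsto 0).comp hbot
  · rw [e1]
    exact ((continuous_edgePoint i j).tendsto 1).comp htop

/-- The Jacobian matrix of the replicator field at the vertex `k`. -/
theorem toMatrix_fderiv_replicatorField_single {U : Matrix ι ι ℝ} {k : ι} (hk : U k k = 0)
    (i j : ι) :
    LinearMap.toMatrix' (fderiv ℝ (replicatorField U) (Pi.single k 1) :
      (ι → ℝ) →ₗ[ℝ] (ι → ℝ)) i j = if i = k then -U j k else if i = j then U i k else 0 := by
  rw [LinearMap.toMatrix'_apply, ContinuousLinearMap.coe_coe]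
  have : (fun j' => if j' = j then (1 : ℝ) else 0) = Pi.single j 1 := by
    ext j'; simp [Pi.single_apply]
  rw [fderiv_replicatorField_apply]
  by_cases hik : i = k
  · subst hik
    by_cases hij : i = j
    · subst hij; simp [hk]
    · simp [hk, hij]
  · simp [hk, hik, Pi.single_apply]

/-- Outside row `k` the Jacobian is diagonal with entries `U j k`, and a nonzero tangent vector has
a nonzero coordinate off `k`. Conversely `e_j - e_k` is an eigenvector. Tangency excludes the
eigenvalue in the direction of the vertex itself. -/
theorem isTangentEigenvalue_single_iff {U : Matrix ι ι ℝ} {k : ι} (hk : U k k = 0) (c : ℂ) :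
    IsTangentEigenvalue U (Pi.single k 1) c ↔ ∃ j, j ≠ k ∧ c = U j k := by
  constructor
  · rintro ⟨v, hv0, hsum, hv⟩
    obtain ⟨j, hjk, hj⟩ : ∃ j, j ≠ k ∧ v j ≠ 0 := by
      by_contra! h
      refine hv0 (funext fun i => ?_)
      by_cases hi : i = k
      · rw [Fintype.sum_eq_single k h] at hsum
        simpa [hi] using hsum
      · exact h i hi
    refine ⟨j, hjk, ?_⟩
    have := congrFun hv j
    simp only [mulVec, dotProduct, Matrix.map_apply,
      toMatrix_fderiv_replicatorField_single hk, if_neg hjk, Pi.smul_apply, smul_eq_mul] at this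
    rw [Fintype.sum_eq_single j (by intro i hi; simp [hi.symm])] at this
    simpa using (mul_right_cancel₀ hj this).symm
  · rintro ⟨j, hjk, rfl⟩
    refine ⟨Pi.single j 1 - Pi.single k 1, fun h => ?_, by simp [Finset.sum_sub_distrib], ?_⟩
    · simpa [hjk] using congrFun h j
    · ext i
      rw [mulVec_sub, mulVec_single_one, mulVec_single_one]
      simp only [Pi.sub_apply, Matrix.col_apply, Matrix.map_apply,
        toMatrix_fderiv_replicatorField_single hk, Pi.smul_apply, smul_eq_mul]
      by_cases hik : i = k
      · subst hik
        simp [hk, hjk.symm]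
      · by_cases hij : i = j
        · subst hij; simp [hik]
        · simp [hik, hij]

theorem isSaddle_single {U : Matrix ι ι ℝ} {k i j : ι} (hk : U k k = 0)
    (hne : ∀ l, l ≠ k → U l k ≠ 0) (hi : 0 < U i k) (hj : U j k < 0) :
    IsSaddle U (Pi.single k 1) where
  mem_simplex := single_mem_stdSimplex ℝ k
  rest := by
    ext l
    by_cases hl : l = k
    · subst hl; simp [replicatorField, hk]
    · simp [replicatorField, hl]
  hyperbolic c hc := by
    obtain ⟨l, hl, rfl⟩ := (isTangentEigenvalue_single_iff hk c).1 hc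
    simpa using hne l hl
  unstable := ⟨U i k, (isTangentEigenvalue_single_iff hk _).2
    ⟨i, by rintro rfl; exact hi.ne' hk, rfl⟩, by simpa using hi⟩
  stable := ⟨U j k, (isTangentEigenvalue_single_iff hk _).2
    ⟨j, by rintro rfl; exact hj.ne hk, rfl⟩, by simpa using hj⟩

end SymmetricGame

/-! ### Lyapunov's direct method for a set -/

namespace SymmetricGame

variable {ι : Type*} [Fintype ι]

/-- A forward solution along which a Lyapunov function `L` decays at rate `δ` while `L < c`
satisfies an exponential bound. -/
theorem le_mul_exp_of_hasDerivWithinAt {f f' : ℝ → ℝ} {c d δ : ℝ} (hδ : 0 < δ) (hd : 0 < d)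
    (hdc : d < c) (h0 : f 0 ≤ d)
    (hf : ∀ t, 0 ≤ t → HasDerivWithinAt f (f' t) (Set.Ici 0) t)
    (hbound : ∀ t, 0 ≤ t → f t < c → f' t ≤ -δ * f t) {t : ℝ} (ht : 0 ≤ t) :
    f t ≤ d * Real.exp (-(δ / 2) * t) := by
  have hB : ∀ s : ℝ, HasDerivAt (fun s => d * Real.exp (-(δ / 2) * s))
      (-(δ / 2) * (d * Real.exp (-(δ / 2) * s))) s := fun s =>
    (((hasDerivAt_id s).const_mul (-(δ / 2))).exp.const_mul d).congr_deriv (by simp; ring)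
  -- The halved rate makes the comparison strict where `f` touches the barrier. The barrier stays
  -- below `c`, so `hbound` applies there without first proving `f < c`.
  refine image_le_of_deriv_right_lt_deriv_boundary' (a := 0) (b := t)
    (fun s hs => ((hf s hs.1).continuousWithinAt).mono Set.Icc_subset_Ici_self)
    (fun s hs => (hf s hs.1).mono (Set.Ici_subset_Ici.2 hs.1)) (by simpa using h0)
    (fun s _ => (hB s).continuousAt.continuousWithinAt) (fun s _ => (hB s).hasDerivWithinAt)
    (fun s hs hfs => ?_) ⟨ht, le_rfl⟩
  have hpos : 0 < d * Real.exp (-(δ / 2) * s) := by positivity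
  have hle : d * Real.exp (-(δ / 2) * s) ≤ d :=
    mul_le_of_le_one_right hd.le (Real.exp_le_one_iff.2 (by nlinarith [hs.1]))
  have h := hbound s hs.1 (by rw [hfs]; linarith)
  rw [hfs] at h
  nlinarith [mul_pos hδ hpos]

/-- Lyapunov's direct method for a set `Γ` that is the zero set, in the simplex, of a
continuous function `L`. -/
theorem isAsymptoticallyStable_of_lyapunov {U : Matrix ι ι ℝ} {Γ N : Set (ι → ℝ)}
    {L : (ι → ℝ) → ℝ} {L' : (ι → ℝ) → ℝ} {δ : ℝ} (hδ : 0 < δ) (hL : Continuous L)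
    (hnonneg : ∀ x ∈ stdSimplex ℝ ι, 0 ≤ L x)
    (hzero : ∀ x ∈ stdSimplex ℝ ι, L x = 0 → x ∈ Γ) (hΓ : ∀ x ∈ Γ, L x = 0)
    (hN : IsOpen N) (hΓN : Γ ⊆ N)
    (hderiv : ∀ (x : ℝ → ι → ℝ) (t : ℝ), HasDerivWithinAt x (replicatorField U (x t))
      (Set.Ici 0) t → HasDerivWithinAt (L ∘ x) (L' (x t)) (Set.Ici 0) t)
    (hdecay : ∀ x ∈ stdSimplex ℝ ι, x ∈ N → L' x ≤ -δ * L x) :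
    IsAsymptoticallyStable U Γ := by
  -- By compactness of the simplex, `L` has a positive minimum outside an open neighbourhood of `Γ`;
  -- so small sublevel sets lie in any given neighbourhood.
  have key : ∀ W ∈ 𝓝ˢ Γ, ∃ c, 0 < c ∧ ∀ x ∈ stdSimplex ℝ ι, L x < c → x ∈ W := by
    intro W hW
    obtain ⟨O, hO, hΓO, hOW⟩ := mem_nhdsSet_iff_exists.1 hW
    have hcomp : IsCompact (stdSimplex ℝ ι \ O) := (isCompact_stdSimplex ℝ ι).diff hO
    obtain hemp | hne := (stdSimplex ℝ ι \ O).eq_empty_or_nonempty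
    · refine ⟨1, one_pos, fun x hx _ => hOW ?_⟩
      by_contra hxO
      exact Set.eq_empty_iff_forall_notMem.1 hemp x ⟨hx, hxO⟩
    · obtain ⟨m, hm, hmin⟩ := hcomp.exists_isMinOn hne hL.continuousOn
      refine ⟨L m, (hnonneg m hm.1).lt_of_ne fun h => hm.2 (hΓO (hzero m hm.1 h.symm)),
        fun x hx hlt => hOW ?_⟩
      by_contra hxO
      exact hlt.not_ge (hmin ⟨hx, hxO⟩)
  have nhds : ∀ c, 0 < c → {x | L x < c} ∈ 𝓝ˢ Γ := fun c hc =>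
    (isOpen_lt hL continuous_const).mem_nhdsSet.2 fun x hx => by simpa [hΓ x hx] using hc
  obtain ⟨a, ha, haN⟩ := key N (hN.mem_nhdsSet.2 hΓN)
  have decay : ∀ c, 0 < c → c ≤ a → ∀ x : ℝ → ι → ℝ,
      IsReplicatorSolutionOn U x (Set.Ici 0) → L (x 0) < c →
      ∃ d, 0 < d ∧ d < c ∧ ∀ t, 0 ≤ t → L (x t) ≤ d * Real.exp (-(δ / 2) * t) := by
    intro c hc hca x hx h0
    have h0' := hnonneg _ (hx.mem_simplex 0 Set.self_mem_Ici)
    -- The midpoint is positive even when `L (x 0) = 0`, as the strict comparison requires.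
    refine ⟨(L (x 0) + c) / 2, by linarith, by linarith, fun t ht => ?_⟩
    exact le_mul_exp_of_hasDerivWithinAt (f := L ∘ x) (f' := fun t => L' (x t)) (c := c) hδ
      (by linarith) (by linarith) (by simp only [Function.comp]; linarith)
      (fun s hs => hderiv x s (hx.ode s hs))
      (fun s hs hlt => hdecay _ (hx.mem_simplex s hs)
        (haN _ (hx.mem_simplex s hs) (hlt.trans_le hca))) ht
  refine ⟨fun W hW => ?_, {x | L x < a}, nhds a ha, fun x hx h0 => ?_⟩
  · obtain ⟨c, hc, hcW⟩ := key W hW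
    refine ⟨{x | L x < min c a}, nhds _ (lt_min hc ha), fun x hx h0 t ht => ?_⟩
    obtain ⟨d, hd, hdc, h⟩ := decay _ (lt_min hc ha) (min_le_right _ _) x hx h0
    refine hcW _ (hx.mem_simplex t ht) ((h t ht).trans_lt ?_)
    refine (mul_le_of_le_one_right hd.le (Real.exp_le_one_iff.2 (by nlinarith))).trans_lt
      (hdc.trans_le (min_le_left _ _))
  · obtain ⟨d, -, -, h⟩ := decay a ha le_rfl x hx h0
    have hlim : Tendsto (fun t => d * Real.exp (-(δ / 2) * t)) atTop (𝓝 0) := by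
      have h1 : Tendsto (fun t : ℝ => -(δ / 2) * t) atTop atBot :=
        tendsto_id.const_mul_atTop_of_neg (by linarith)
      simpa using (Real.tendsto_exp_atBot.comp h1).const_mul d
    intro W hW
    obtain ⟨c, hc, hcW⟩ := key W hW
    have hev := hlim.eventually_lt_const hc
    change ∀ᶠ t in atTop, x t ∈ W
    filter_upwards [eventually_ge_atTop 0, hev] with t ht hlt
    exact hcW _ (hx.mem_simplex t ht) ((h t ht).trans_lt hlt)

end SymmetricGame

/-! ### The heteroclinic cycle and the failure of the Nash property -/

open SymmetricGame

theorem isSaddle_vertices567 {ε : ℝ} (hε : 0 < ε) (hε' : ε < 1 / 6) (k : Fin 3) :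
    IsSaddle (game77 ε) (vertices567 k) := by
  fin_cases k
  · refine isSaddle_single (i := 5) (j := 6) (by simp [game77]) (fun l hl => ?_)
      (by simpa [game77] using hε) (by simp [game77])
    fin_cases l <;> simp [game77] at hl ⊢ <;> linarith
  · refine isSaddle_single (i := 6) (j := 4) (by simp [game77]) (fun l hl => ?_)
      (by simpa [game77] using hε) (by simp [game77])
    fin_cases l <;> simp [game77] at hl ⊢ <;> linarith
  · refine isSaddle_single (i := 4) (j := 5) (by simp [game77]) (fun l hl => ?_)
      (by simpa [game77] using hε) (by simp [game77])
    fin_cases l <;> simp [game77] at hl ⊢ <;> linarith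

theorem apply_eq_zero_of_mem_Gamma567 {x : Fin 7 → ℝ} (hx : x ∈ Gamma567) :
    x 0 = 0 ∧ x 1 = 0 ∧ x 2 = 0 ∧ x 3 = 0 := by
  obtain ⟨⟨hx0, hx1⟩, hs, -⟩ := hx
  rw [Fin.sum_univ_seven] at hx1
  have h0 := hx0 0
  have h1 := hx0 1
  have h2 := hx0 2
  have h3 := hx0 3
  refine ⟨?_, ?_, ?_, ?_⟩ <;> linarith

theorem vertices567_eq_single (k : Fin 3) : vertices567 k = Pi.single (![4, 5, 6] k) 1 := by
  fin_cases k <;> rfl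

theorem vertices567_injective : Function.Injective vertices567 := by
  have hinj : Function.Injective (![4, 5, 6] : Fin 3 → Fin 7) := by decide
  intro i j h
  have hij : (![4, 5, 6] : Fin 3 → Fin 7) i = ![4, 5, 6] j := by
    by_contra hne
    rw [vertices567_eq_single, vertices567_eq_single] at h
    simpa [Pi.single_apply, hne] using congrFun h (![4, 5, 6] i)
  exact hinj hij

theorem edgePoint_vertices_mem_Gamma567 (k : Fin 3) {s : ℝ} (h0 : 0 ≤ s) (h1 : s ≤ 1) :
    edgePoint (![4, 5, 6] k) (![4, 5, 6] (k + 1)) s ∈ Gamma567 := by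
  refine ⟨edgePoint_mem_stdSimplex _ _ h0 h1, ?_, ?_⟩ <;>
    fin_cases k <;> simp [edgePoint]

theorem onConnectingOrbit_vertices567 {ε : ℝ} (hε : 0 < ε) (k : Fin 3) {s : ℝ} (h0 : 0 < s)
    (h1 : s < 1) :
    OnConnectingOrbit (game77 ε) Gamma567 (vertices567 k) (vertices567 (k + 1))
      (edgePoint (![4, 5, 6] k) (![4, 5, 6] (k + 1)) s) := by
  rw [vertices567_eq_single, vertices567_eq_single]
  refine onConnectingOrbit_edgePoint ?_ ?_ ?_ ?_ ?_
    (fun s h0 h1 => edgePoint_vertices_mem_Gamma567 k h0 h1) h0 h1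
  all_goals fin_cases k <;> simp [game77, hε]

theorem exists_edgePoint_of_mem_Gamma567 {x : Fin 7 → ℝ} (hx : x ∈ Gamma567)
    (hv : x ∉ Set.range vertices567) :
    ∃ k : Fin 3, ∃ s, 0 < s ∧ s < 1 ∧
      x = edgePoint (![4, 5, 6] k) (![4, 5, 6] (k + 1)) s := by
  obtain ⟨z0, z1, z2, z3⟩ := apply_eq_zero_of_mem_Gamma567 hx
  obtain ⟨⟨hx0, -⟩, hs, hp⟩ := hx
  obtain ⟨k, s, hs0, hs1, hxk⟩ : ∃ k : Fin 3, ∃ s, 0 ≤ s ∧ s ≤ 1 ∧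
      x = edgePoint (![4, 5, 6] k) (![4, 5, 6] (k + 1)) s := by
    have h4 := hx0 4
    have h5 := hx0 5
    have h6 := hx0 6
    -- The vanishing coordinate selects the opposite edge; `s` is the weight of that edge's target
    -- vertex.
    rcases mul_eq_zero.1 hp with h | h
    · rcases mul_eq_zero.1 h with h | h
      · refine ⟨1, x 6, h6, by linarith, funext fun i => ?_⟩
        fin_cases i <;> simp [edgePoint, z0, z1, z2, z3, h]; linarith
      · refine ⟨2, x 4, h4, by linarith, funext fun i => ?_⟩
        fin_cases i <;> simp [edgePoint, z0, z1, z2, z3, h]; linarith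
    · refine ⟨0, x 5, h5, by linarith, funext fun i => ?_⟩
      fin_cases i <;> simp [edgePoint, z0, z1, z2, z3, h]; linarith
  refine ⟨k, s, hs0.lt_of_ne ?_, hs1.lt_of_ne ?_, hxk⟩
  · rintro rfl
    refine hv ⟨k, ?_⟩
    rw [hxk]
    fin_cases k <;> simp [edgePoint, vertices567]
  · rintro rfl
    refine hv ⟨k + 1, ?_⟩
    rw [hxk]
    fin_cases k <;> simp [edgePoint, vertices567]

theorem isHeteroclinicCycle_Gamma567 {ε : ℝ} (hε : 0 < ε) (hε' : ε < 1 / 6) :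
    IsHeteroclinicCycle (game77 ε) Gamma567 vertices567 where
  two_le := by norm_num
  injective := vertices567_injective
  mem k := by
    have h := edgePoint_vertices_mem_Gamma567 k le_rfl zero_le_one
    fin_cases k <;> simpa [edgePoint, vertices567] using h
  saddle := isSaddle_vertices567 hε hε'
  consists x hx hv := by
    obtain ⟨k, s, h0, h1, rfl⟩ := exists_edgePoint_of_mem_Gamma567 hx hv
    exact ⟨k, onConnectingOrbit_vertices567 hε k h0 h1⟩
  connects k := by
    refine ⟨_, edgePoint_vertices_mem_Gamma567 k (s := 1 / 2) (by norm_num) (by norm_num), ?_,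
      onConnectingOrbit_vertices567 hε k (by norm_num) (by norm_num)⟩
    rintro ⟨l, hl⟩
    have hne : (![4, 5, 6] : Fin 3 → Fin 7) k ≠ ![4, 5, 6] (k + 1) := by
      clear hl
      revert k; decide
    have h := congrFun hl (![4, 5, 6] k)
    rw [vertices567_eq_single] at h
    simp only [edgePoint, Pi.add_apply, Pi.single_apply, hne, if_true, if_false] at h
    split_ifs at h <;> norm_num at h

theorem not_isNashEquilibrium_n567 {ε : ℝ} (hε : 0 < ε) :
    ¬ IsNashEquilibrium (game77 ε) n567 n567 := by
  rintro ⟨-, -, h, -⟩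
  -- Against `n567` the first strategy earns `-1/3 + ε`, while `n567` earns only `(ε - 1) / 3`.
  have := h _ (single_mem_stdSimplex ℝ 0)
  simp [game77, n567, mulVec, dotProduct, Fin.sum_univ_seven] at this
  linarith

/-! ### The Lyapunov function and its decay near the cycle -/

/-- The growth rate of the `i`-th strategy under the replicator dynamics. -/
noncomputable def growthRate (ε : ℝ) (x : Fin 7 → ℝ) (i : Fin 7) : ℝ :=
  (game77 ε *ᵥ x) i - x ⬝ᵥ (game77 ε *ᵥ x)

theorem continuous_growthRate (ε : ℝ) (i : Fin 7) : Continuous fun x => growthRate ε x i := by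
  unfold growthRate mulVec dotProduct
  fun_prop

/-- The antisymmetric product of the last three coordinates; it compensates for the outward drift
along the middle of the edges. -/
def vandermonde567 (x : Fin 7 → ℝ) : ℝ := (x 4 - x 5) * (x 5 - x 6) * (x 4 - x 6)

/-- The derivative of `vandermonde567` along the replicator dynamics. -/
noncomputable def vandermondeDeriv (ε : ℝ) (x : Fin 7 → ℝ) : ℝ :=
  (x 4 * growthRate ε x 4 - x 5 * growthRate ε x 5) * (x 5 - x 6) * (x 4 - x 6) +
    (x 4 - x 5) * (x 5 * growthRate ε x 5 - x 6 * growthRate ε x 6) * (x 4 - x 6) +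
    (x 4 - x 5) * (x 5 - x 6) * (x 4 * growthRate ε x 4 - x 6 * growthRate ε x 6)

/-- The Lyapunov function of `Gamma567`. -/
noncomputable def lyapunov567 (x : Fin 7 → ℝ) : ℝ :=
  x 4 * x 5 * x 6 + x 3 + (x 0 + x 1 + x 2) * Real.exp (vandermonde567 x)

/-- The derivative of `lyapunov567` along the replicator dynamics. -/
noncomputable def lyapunovDeriv (ε : ℝ) (x : Fin 7 → ℝ) : ℝ :=
  x 4 * x 5 * x 6 * (growthRate ε x 4 + growthRate ε x 5 + growthRate ε x 6) +
    x 3 * growthRate ε x 3 +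
    (x 0 * (growthRate ε x 0 + vandermondeDeriv ε x) +
      x 1 * (growthRate ε x 1 + vandermondeDeriv ε x) +
      x 2 * (growthRate ε x 2 + vandermondeDeriv ε x)) * Real.exp (vandermonde567 x)

/-- The neighbourhood of `Gamma567` in which all terms of `lyapunov567` decay at rate `1 / 200`. -/
def decayRegion (ε : ℝ) : Set (Fin 7 → ℝ) :=
  {x | growthRate ε x 4 + growthRate ε x 5 + growthRate ε x 6 < -(1 / 200)} ∩
    {x | growthRate ε x 3 < -(1 / 200)} ∩
    ({x | growthRate ε x 0 + vandermondeDeriv ε x < -(1 / 200)} ∩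
      {x | growthRate ε x 1 + vandermondeDeriv ε x < -(1 / 200)} ∩
      {x | growthRate ε x 2 + vandermondeDeriv ε x < -(1 / 200)})

theorem continuous_vandermondeDeriv (ε : ℝ) : Continuous (vandermondeDeriv ε) := by
  have h := continuous_growthRate ε
  unfold vandermondeDeriv
  fun_prop

theorem isOpen_decayRegion (ε : ℝ) : IsOpen (decayRegion ε) := by
  have h := continuous_growthRate ε
  have h' := continuous_vandermondeDeriv ε
  refine ((isOpen_lt ?_ continuous_const).inter (isOpen_lt ?_ continuous_const)).inter
    (((isOpen_lt ?_ continuous_const).inter (isOpen_lt ?_ continuous_const)).inter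
      (isOpen_lt ?_ continuous_const))
  all_goals fun_prop

/-- The left side is the rate of the first three strategies on an edge, corrected by the drift of
`vandermonde567`. For fixed `p`, `q` it is affine in `ε`, so the endpoints `ε = 0` (`v0`) and `ε =
1/6` (`v1`) suffice. -/
theorem edge_rate_lt {ε p q : ℝ} (hε : 0 < ε) (hε' : ε < 1 / 6) (hp : 0 ≤ p) (hq : 0 ≤ q)
    (hpq : p + q = 1) :
    -1 / 3 + ε + (1 - ε) * (p * q) + p * q * (1 - 6 * (p * q)) * (ε * p + q) < -(1 / 200) := by
  set r := p * q with hr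
  have hr0 : 0 ≤ r := mul_nonneg hp hq
  have hr1 : r ≤ 1 / 4 := by nlinarith [sq_nonneg (p - q)]
  have hp' : p = 1 - q := by linarith
  -- Indeed `q = r + q ^ 2` and `r ≤ q`. This lower bound on `q` is needed when `r ≥ 1/6`, where the
  -- correction is negative and helps more for larger `q`.
  have hqr : r + r ^ 2 ≤ q := by
    have h1 : q - (r + r ^ 2) = q ^ 2 * (1 - p ^ 2) := by rw [hr, hp']; ring
    have h2 : 0 ≤ q ^ 2 * (1 - p ^ 2) := by
      have : p ^ 2 ≤ 1 := by nlinarith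
      exact mul_nonneg (sq_nonneg q) (by linarith)
    linarith
  have hq1 : q ≤ 1 := by linarith
  have v0 : -1 / 3 + r + r * (1 - 6 * r) * q < -(1 / 200) := by
    rcases le_total r (1 / 6) with h | h
    · have := mul_le_mul_of_nonneg_left hq1 (mul_nonneg hr0 (by linarith : 0 ≤ 1 - 6 * r))
      nlinarith
    · have := mul_nonneg (mul_nonneg hr0 (by linarith : 0 ≤ 6 * r - 1)) hq
      nlinarith
  have v1 : -1 / 6 + 5 / 6 * r + r * (1 - 6 * r) * (1 / 6 + 5 / 6 * q) < -(1 / 200) := by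
    rcases le_total r (1 / 6) with h | h
    · have := mul_le_mul_of_nonneg_left hq1 (mul_nonneg hr0 (by linarith : 0 ≤ 1 - 6 * r))
      -- With `q` replaced by `1` the bound is a quadratic in `r` with its maximum at `11/72`.
      nlinarith [sq_nonneg (r - 11 / 72)]
    · have h1 := mul_le_mul_of_nonneg_left hqr (mul_nonneg hr0 (by linarith : 0 ≤ 6 * r - 1))
      have h2 : -1 / 6 + 5 / 6 * r - r * (6 * r - 1) * (1 / 6 + 5 / 6 * (r + r ^ 2))
          < -(1 / 200) := by
        -- The polynomial has its maximum on `[1/6, 1/4]` close to `r = 23/100`, with value about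
        -- `-0.01`; this is the tight case for the constant `1/200`.
        nlinarith [mul_nonneg (sub_nonneg.2 h) (sub_nonneg.2 hr1), sq_nonneg (r - 23 / 100),
          mul_nonneg (mul_nonneg hr0 (sub_nonneg.2 h)) (sub_nonneg.2 hr1),
          mul_nonneg hr0 (sq_nonneg (r - 23 / 100)), sq_nonneg (r ^ 2 - 23 / 100 * r)]
      nlinarith
  have hcomb : -1 / 3 + ε + (1 - ε) * r + r * (1 - 6 * r) * (ε * p + q) =
      (1 - 6 * ε) * (-1 / 3 + r + r * (1 - 6 * r) * q) +
        6 * ε * (-1 / 6 + 5 / 6 * r + r * (1 - 6 * r) * (1 / 6 + 5 / 6 * q)) := by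
    rw [hp']; ring
  rw [hcomb]
  nlinarith

theorem Gamma567_subset_decayRegion {ε : ℝ} (hε : 0 < ε) (hε' : ε < 1 / 6) :
    Gamma567 ⊆ decayRegion ε := by
  intro x hx
  obtain ⟨z0, z1, z2, z3⟩ := apply_eq_zero_of_mem_Gamma567 hx
  obtain ⟨⟨hx0, -⟩, hs, hp⟩ := hx
  have h4 := hx0 4
  have h5 := hx0 5
  have h6 := hx0 6
  set q := x 4 * x 5 + x 5 * x 6 + x 6 * x 4 with hq
  have avg : x ⬝ᵥ (game77 ε *ᵥ x) = (ε - 1) * q := by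
    simp [game77, mulVec, dotProduct, Fin.sum_univ_seven, z0, z1, z2, z3, hq]
    ring
  have g3 : growthRate ε x 3 = -1 / 3 * (x 4 + x 5 + x 6) + (1 - ε) * q := by
    rw [growthRate, avg]
    simp [game77, mulVec, dotProduct, Fin.sum_univ_seven, z0, z1, z2, z3]
    ring
  have g4 : growthRate ε x 4 = -x 5 + ε * x 6 + (1 - ε) * q := by
    rw [growthRate, avg]
    simp [game77, mulVec, dotProduct, Fin.sum_univ_seven, z0, z1, z2, z3]
    ring
  have g5 : growthRate ε x 5 = -x 6 + ε * x 4 + (1 - ε) * q := by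
    rw [growthRate, avg]
    simp [game77, mulVec, dotProduct, Fin.sum_univ_seven, z0, z1, z2, z3]
    ring
  have g6 : growthRate ε x 6 = -x 4 + ε * x 5 + (1 - ε) * q := by
    rw [growthRate, avg]
    simp [game77, mulVec, dotProduct, Fin.sum_univ_seven, z0, z1, z2, z3]
    ring
  have gA : ∀ i : Fin 7, i = 0 ∨ i = 1 ∨ i = 2 →
      growthRate ε x i = (-1 / 3 + ε) * (x 4 + x 5 + x 6) + (1 - ε) * q := by
    rintro i (rfl | rfl | rfl) <;> rw [growthRate, avg] <;>
      simp [game77, mulVec, dotProduct, Fin.sum_univ_seven, z0, z1, z2, z3] <;> ring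
  -- On an edge `q` is the product of two weights with sum `1`. Cyclic permutations of the last
  -- three coordinates preserve `vandermonde567`, so all three edges reduce to `edge_rate_lt`.
  obtain ⟨hq4, hv⟩ : q ≤ 1 / 4 ∧ (-1 / 3 + ε) * (x 4 + x 5 + x 6) + (1 - ε) * q +
      vandermondeDeriv ε x < -(1 / 200) := by
    rcases mul_eq_zero.1 hp with h | h
    · rcases mul_eq_zero.1 h with h | h
      · have hs' : x 5 + x 6 = 1 := by linarith
        refine ⟨by rw [hq, h]; nlinarith [sq_nonneg (x 5 - x 6)], ?_⟩
        have := edge_rate_lt hε hε' h5 h6 hs'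
        have h5' : x 5 = 1 - x 6 := by linarith
        refine lt_of_eq_of_lt ?_ this
        rw [vandermondeDeriv, g4, g5, g6, hq, h, h5']
        ring
      · have hs' : x 6 + x 4 = 1 := by linarith
        refine ⟨by rw [hq, h]; nlinarith [sq_nonneg (x 6 - x 4)], ?_⟩
        have := edge_rate_lt hε hε' h6 h4 hs'
        have h6' : x 6 = 1 - x 4 := by linarith
        refine lt_of_eq_of_lt ?_ this
        rw [vandermondeDeriv, g4, g5, g6, hq, h, h6']
        ring
    · have hs' : x 4 + x 5 = 1 := by linarith
      refine ⟨by rw [hq, h]; nlinarith [sq_nonneg (x 4 - x 5)], ?_⟩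
      have := edge_rate_lt hε hε' h4 h5 hs'
      have h4' : x 4 = 1 - x 5 := by linarith
      refine lt_of_eq_of_lt ?_ this
      rw [vandermondeDeriv, g4, g5, g6, hq, h, h4']
      ring
  refine ⟨⟨?_, ?_⟩, ⟨?_, ?_⟩, ?_⟩ <;> rw [Set.mem_ofPred_eq]
  -- The three rates add up to `(1 - ε) (3 q - 1)`, at most `-(1 - ε) / 4`.
  · rw [g4, g5, g6]
    nlinarith
  · rw [g3]
    nlinarith
  · rwa [gA 0 (by simp)]
  · rwa [gA 1 (by simp)]
  · rwa [gA 2 (by simp)]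

theorem hasDerivWithinAt_lyapunov567 {ε : ℝ} (x : ℝ → Fin 7 → ℝ) (t : ℝ)
    (hx : HasDerivWithinAt x (replicatorField (game77 ε) (x t)) (Set.Ici 0) t) :
    HasDerivWithinAt (lyapunov567 ∘ x) (lyapunovDeriv ε (x t)) (Set.Ici 0) t := by
  have h : ∀ i, HasDerivWithinAt (fun s => x s i) (x t i * growthRate ε (x t) i) (Set.Ici 0) t :=
    fun i => hasDerivWithinAt_pi.1 hx i
  have hv : HasDerivWithinAt (fun s => vandermonde567 (x s)) (vandermondeDeriv ε (x t))
      (Set.Ici 0) t :=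
    ((((h 4).sub (h 5)).mul ((h 5).sub (h 6))).mul ((h 4).sub (h 6))).congr_deriv (by
      simp only [vandermondeDeriv, Pi.mul_apply, Pi.sub_apply]
      ring)
  refine (((((h 4).mul (h 5)).mul (h 6)).add (h 3)).add
    ((((h 0).add (h 1)).add (h 2)).mul hv.exp)).congr_deriv ?_
  simp only [lyapunovDeriv, Pi.mul_apply, Pi.add_apply]
  ring

/-- Each summand of `lyapunov567` is nonnegative and has logarithmic derivative below `-1/200` in
the region, so the bounds add up. -/
theorem lyapunovDeriv_le {ε : ℝ} {x : Fin 7 → ℝ} (hx : x ∈ stdSimplex ℝ (Fin 7))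
    (hN : x ∈ decayRegion ε) : lyapunovDeriv ε x ≤ -(1 / 200) * lyapunov567 x := by
  obtain ⟨⟨hP, h3⟩, ⟨h0, h1⟩, h2⟩ := hN
  rw [Set.mem_ofPred_eq] at hP h3 h0 h1 h2
  have hP' := mul_le_mul_of_nonneg_left hP.le (mul_nonneg (mul_nonneg (hx.1 4) (hx.1 5)) (hx.1 6))
  have h3' := mul_le_mul_of_nonneg_left h3.le (hx.1 3)
  have h0' := mul_le_mul_of_nonneg_left h0.le (hx.1 0)
  have h1' := mul_le_mul_of_nonneg_left h1.le (hx.1 1)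
  have h2' := mul_le_mul_of_nonneg_left h2.le (hx.1 2)
  have hA := mul_le_mul_of_nonneg_right (add_le_add (add_le_add h0' h1') h2')
    (Real.exp_pos (vandermonde567 x)).le
  rw [lyapunovDeriv, lyapunov567]
  linarith

theorem lyapunov567_nonneg {x : Fin 7 → ℝ} (hx : x ∈ stdSimplex ℝ (Fin 7)) :
    0 ≤ lyapunov567 x := by
  have h := hx.1
  have := h 0; have := h 1; have := h 2; have := h 3; have := h 4; have := h 5; have := h 6
  unfold lyapunov567
  positivity

theorem mem_Gamma567_of_lyapunov567_eq_zero {x : Fin 7 → ℝ} (hx : x ∈ stdSimplex ℝ (Fin 7))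
    (h : lyapunov567 x = 0) : x ∈ Gamma567 := by
  have h0 := hx.1 0
  have h1 := hx.1 1
  have h2 := hx.1 2
  have h3 := hx.1 3
  have hP := mul_nonneg (mul_nonneg (hx.1 4) (hx.1 5)) (hx.1 6)
  have hE := Real.exp_pos (vandermonde567 x)
  have hA : 0 ≤ (x 0 + x 1 + x 2) * Real.exp (vandermonde567 x) := by positivity
  have hsum := hx.2
  rw [Fin.sum_univ_seven] at hsum
  rw [lyapunov567] at h
  have hA0 : x 0 + x 1 + x 2 = 0 :=
    (mul_eq_zero.1 (by linarith :
      (x 0 + x 1 + x 2) * Real.exp (vandermonde567 x) = 0)).resolve_right hE.ne'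
  exact ⟨hx, by linarith, by linarith⟩

theorem lyapunov567_eq_zero {x : Fin 7 → ℝ} (hx : x ∈ Gamma567) : lyapunov567 x = 0 := by
  obtain ⟨z0, z1, z2, z3⟩ := apply_eq_zero_of_mem_Gamma567 hx
  simp [lyapunov567, z0, z1, z2, z3, hx.2.2]

theorem continuous_lyapunov567 : Continuous lyapunov567 := by
  unfold lyapunov567 vandermonde567
  fun_prop

theorem isAsymptoticallyStable_Gamma567 {ε : ℝ} (hε : 0 < ε) (hε' : ε < 1 / 6) :
    IsAsymptoticallyStable (game77 ε) Gamma567 :=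
  isAsymptoticallyStable_of_lyapunov (by norm_num : (0 : ℝ) < 1 / 200) continuous_lyapunov567
    (fun _ => lyapunov567_nonneg) (fun _ => mem_Gamma567_of_lyapunov567_eq_zero)
    (fun _ => lyapunov567_eq_zero) (isOpen_decayRegion ε) (Gamma567_subset_decayRegion hε hε')
    hasDerivWithinAt_lyapunov567 (fun _ => lyapunovDeriv_le)

theorem proposition3p4 (ε : ℝ) (hε : 0 < ε) (hε' : ε < 1 / 6) :
    SymmetricGame.IsHeteroclinicCycle (game77 ε) Gamma567 vertices567 ∧
    ¬ SymmetricGame.IsNashEquilibrium (game77 ε) n567 n567 ∧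
    SymmetricGame.IsAsymptoticallyStable (game77 ε) Gamma567 :=
  ⟨isHeteroclinicCycle_Gamma567 hε hε', not_isNashEquilibrium_n567 hε,
    isAsymptoticallyStable_Gamma567 hε hε'⟩
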